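/- For positive integers $m,n$ the plane 8.8.4 lattice graph $G_{m,n}$ is the following finite piece of the 8.8.4 (truncated square) tiling. Place $4$-cycles ("cells") with a left, a right, an upper and a lower corner at the positions $(i,j)$, $1\le i\le m$, $1\le j\le n$; in each cell the left and right corners are both adjacent to the upper and lower corners. Join the right corner of cell $(i,j)$ to the left corner of cell $(i,j+1)$, and the lower corner of cell $(i,j)$ to the upper corner of cell $(i+1,j)$; finally delete the corners of boundary cells that point out of the array. Let $f(m,n)$ be the number of independent sets of $G_{m,n}$, and $k(m,n)$ its number of vertices. Let $R_m$ be the set of $0$-$1$ vectors with $2m-2$ entries in which entries $2k-1$ and $2k$ are not both $1$ ($1\le k\le m-1$), and $K_m$ the set of all $0$-$1$ vectors with $m$ entries. Let $T_{m,1}$ be the $R_m\times K_m$ matrix whose entry at $(v,w)$ is $1$ if, for no $k$, $v_{2k-1}=w_k=1$ or $v_{2k}=w_{k+1}=1$, and $0$ otherwise; let $T_{m,2}$ be the $K_m\times K_m$ matrix whose entry at $(\alpha,\beta)$ is $1$ if $\alpha\cdot\beta=0$ and $0$ otherwise; and let $T_m=T_{m,1}T_{m,2}T_{m,1}^{\mathsf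 T}$. For $c\ge1$ let $B_c=B_{c,1}T_{c,2}B_{c,1}^{\mathsf T}$, where $B_{c,1}$ is the $R_{c+1}\times K_c$ matrix defined in the same way as $T_{m,1}$, but with $1\le k\le c$ and with $w_{c+1}$ read as $w_1$ (the transfer matrix of the cylindrical 8.8.4 lattice with $c$ cells around the cylinder). Let $\lambda_m$ and $\xi_c$ be the largest eigenvalues of $T_m$ and $B_c$. Then, for all $m,n\ge1$, $T_m$ is symmetric, $f(m,n)=\mathbf 1\cdot T_m^{\,n-1}\mathbf 1$ and $k(m,n)=4mn-2m-2n$. The double limit $L=\lim_{m,n\to\infty}f(m,n)^{1/mn}$ exists and satisfies $$\Big(\frac{\lambda_{p+2q+1}}{\lambda_{2q+1}}\Big)^{1/p}\le L\quad(p\ge1,\ q\ge0),\qquad L\le \xi_{2k}^{1/2k}\quad(k\ge1),$$ and $4.631583396\le L<5.765456529$. The entropy constant $\eta=\lim_{m,n\to\infty}f(m,n)^{1/k(m,n)}$ exists, equals $L^{1/4}$, and satisfies $1.467007629\le\eta<1.549560102$. -/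

import Mathlib

open Filter Topology

namespace Lattice884

/-- Vertices of the 8.8.4 lattice graph with `m` rows and `n` columns of 4-cycles.  The 4-cycles
("cells") sit at the positions `(i, j)`, `i < m`, `j < n`.  Two horizontally adjacent cells
`(i, j)`, `(i, j + 1)` are joined by a bond whose two ends are `inl (i, j, false)`, in the cell
`(i, j)`, and `inl (i, j, true)`, in the cell `(i, j + 1)`; two vertically adjacent cells `(i, j)`,
`(i + 1, j)` are joined by a bond with the ends `inr (i, j, false)`, in the cell `(i, j)`, and
`inr (i, j, true)`, in the cell `(i + 1, j)`.  The corners of the boundary cells that would point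
out of the `m × n` array are absent. -/
abbrev Vert (m n : ℕ) : Type :=
  (Fin m × Fin (n - 1) × Bool) ⊕ (Fin (m - 1) × Fin n × Bool)

/-- The cell that contains the end `b` of a horizontal bond. -/
def hCell {m n : ℕ} (h : Fin m × Fin (n - 1) × Bool) : ℕ × ℕ :=
  (h.1.val, h.2.1.val + h.2.2.toNat)

/-- The cell that contains the end `b` of a vertical bond. -/
def vCell {m n : ℕ} (v : Fin (m - 1) × Fin n × Bool) : ℕ × ℕ :=
  (v.1.val + v.2.2.toNat, v.2.1.val)

/-- Adjacency: the two ends of a bond are adjacent (the edges between two octagons), and within a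
cell each of the left and right corners is adjacent to each of the upper and lower corners (the
edges of the squares). -/
def Adj884 {m n : ℕ} : Vert m n → Vert m n → Prop
  | .inl a, .inl b => a.1 = b.1 ∧ a.2.1 = b.2.1 ∧ a.2.2 ≠ b.2.2
  | .inr a, .inr b => a.1 = b.1 ∧ a.2.1 = b.2.1 ∧ a.2.2 ≠ b.2.2
  | .inl h, .inr v => hCell h = vCell v
  | .inr v, .inl h => hCell h = vCell v

/-- The plane 8.8.4 lattice graph `G_{m,n}`. -/
def graph (m n : ℕ) : SimpleGraph (Vert m n) where
  Adj := Adj884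
  symm := ⟨by
    rintro (a | a) (b | b) h
    · exact ⟨h.1.symm, h.2.1.symm, h.2.2.symm⟩
    · exact h
    · exact h
    · exact ⟨h.1.symm, h.2.1.symm, h.2.2.symm⟩⟩
  loopless := ⟨by
    rintro (a | a) h
    · exact h.2.2 rfl
    · exact h.2.2 rfl⟩

/-- `f(m,n)`: the number of independent sets of `G_{m,n}`. -/
noncomputable def numIndep (m n : ℕ) : ℕ :=
  Nat.card {S : Set (Vert m n) // (graph m n).IsIndepSet S}

/-- 0-1 vectors with `2 r` entries, arranged in `r` pairs, such that no pair consists of two ones.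
There are `3 ^ r` of them. -/
abbrev PairVec (r : ℕ) : Type :=
  {v : Fin r × Bool → Bool // ∀ k, ¬(v (k, false) = true ∧ v (k, true) = true)}

/-- All 0-1 vectors with `s` entries. -/
abbrev BitVec01 (s : ℕ) : Type := Fin s → Bool

/-- Transfer matrix of step one: from a column of `m - 1` vertical bonds to the next column, which
has one vertex in each of the `m` rows.  The end `b` of the bond number `k` is adjacent to the
vertex in row `k + b`. -/
def planeStep (m : ℕ) : Matrix (PairVec (m - 1)) (BitVec01 m) ℝ :=
  fun v w => if ∀ (k : Fin (m - 1)) (b : Bool) (i : Fin m),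
    i.val = k.val + b.toNat → ¬(v.1 (k, b) = true ∧ w i = true) then 1 else 0

/-- Transfer matrix of step two: orthogonality of 0-1 vectors. -/
def orthStep (s : ℕ) : Matrix (BitVec01 s) (BitVec01 s) ℝ :=
  fun α β => if ∀ i, ¬(α i = true ∧ β i = true) then 1 else 0

/-- The triple-product transfer matrix `T_m` of the plane 8.8.4 lattice with `m` rows of cells;
the matrix of step three is the transpose of the matrix of step one. -/
noncomputable def planeTransfer (m : ℕ) : Matrix (PairVec (m - 1)) (PairVec (m - 1)) ℝ :=
  planeStep m * orthStep m * (planeStep m).transpose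

/-- Step one on the cylinder with `c` cells around it: from a closed ring of `c` bonds to the next
row, which has one vertex in each of the `c` cells.  The end `b` of the bond number `k` is adjacent
to the vertex in the cell `k + b` modulo `c`. -/
def cylStep (c : ℕ) : Matrix (PairVec c) (BitVec01 c) ℝ :=
  fun v w => if ∀ (k : Fin c) (b : Bool) (i : Fin c),
    i.val = (k.val + b.toNat) % c → ¬(v.1 (k, b) = true ∧ w i = true) then 1 else 0

/-- The triple-product transfer matrix of the cylindrical 8.8.4 lattice with `c` cells around. -/
noncomputable def cylTransfer (c : ℕ) : Matrix (PairVec c) (PairVec c) ℝ :=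
  cylStep c * orthStep c * (cylStep c).transpose

/-- The largest eigenvalue of a real symmetric matrix (its spectrum is finite and non-empty). -/
noncomputable def maxEigenvalue {ι : Type} [Fintype ι] [DecidableEq ι] (A : Matrix ι ι ℝ) : ℝ :=
  sSup (spectrum ℝ A)

end Lattice884

namespace Lattice884

/-- The ends of the bonds of a path with `n` cells. -/
def pathEnd (n : ℕ) (k : Fin (n - 1)) (b : Bool) : Fin n :=
  ⟨k.val + b.toNat, by have := k.isLt; cases b <;> simp <;> omega⟩

/-- The ends of the bonds of a closed ring with `c` cells. -/
def ringEnd (c : ℕ) (k : Fin c) (b : Bool) : Fin c :=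
  ⟨(k.val + b.toNat) % c, Nat.mod_lt _ k.pos⟩

/-- Step one for an arbitrary system of bonds: the end `b` of the bond `k` lies in the cell
`e k b`. -/
def bondStep {r s : ℕ} (e : Fin r → Bool → Fin s) : Matrix (PairVec r) (BitVec01 s) ℝ :=
  fun v w => if ∀ k b, ¬(v.1 (k, b) = true ∧ w (e k b) = true) then 1 else 0

/-- The triple-product transfer matrix of an arbitrary system of bonds. -/
noncomputable def bondTransfer {r s : ℕ} (e : Fin r → Bool → Fin s) :
    Matrix (PairVec r) (PairVec r) ℝ :=
  bondStep e * orthStep s * (bondStep e).transpose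

theorem planeTransfer_eq (m : ℕ) : planeTransfer m = bondTransfer (pathEnd m) := by
  have h : planeStep m = bondStep (pathEnd m) := by
    ext v w
    unfold planeStep bondStep
    congr 1
    refine propext ⟨fun h k b => h k b _ rfl, fun h k b i hi => ?_⟩
    have : i = pathEnd m k b := Fin.ext hi
    rw [this]; exact h k b
  rw [planeTransfer, bondTransfer, h]

theorem cylTransfer_eq (c : ℕ) : cylTransfer c = bondTransfer (ringEnd c) := by
  have h : cylStep c = bondStep (ringEnd c) := by
    ext v w
    unfold cylStep bondStep
    congr 1
    refine propext ⟨fun h k b => h k b _ rfl, fun h k b i hi => ?_⟩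
    have : i = ringEnd c k b := Fin.ext hi
    rw [this]; exact h k b
  rw [cylTransfer, bondTransfer, h]

theorem orthStep_isSymm (s : ℕ) : (orthStep s).IsSymm := by
  ext v w
  simp only [Matrix.transpose_apply, orthStep, and_comm]

theorem bondTransfer_isSymm {r s : ℕ} (e : Fin r → Bool → Fin s) : (bondTransfer e).IsSymm := by
  rw [Matrix.IsSymm, bondTransfer, Matrix.transpose_mul, Matrix.transpose_mul,
    Matrix.transpose_transpose, (orthStep_isSymm s).eq, Matrix.mul_assoc]

/-- Pairs of 0-1 vectors as one doubly indexed vector. -/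
def pairEquiv (s : ℕ) : (Fin s × Bool → Bool) ≃ BitVec01 s × BitVec01 s where
  toFun z := (fun i => z (i, false), fun i => z (i, true))
  invFun p x := cond x.2 (p.2 x.1) (p.1 x.1)
  left_inv _ := by ext ⟨i, b⟩; cases b <;> rfl
  right_inv _ := rfl

theorem bondTransfer_apply {r s : ℕ} (e : Fin r → Bool → Fin s) (a b : PairVec r) :
    bondTransfer e a b = ∑ z : PairVec s,
      if ∀ k c d, ¬((cond d b a).1 (k, c) = true ∧ z.1 (e k c, d) = true) then (1 : ℝ) else 0 := by
  have h1 : ∀ g : (Fin s × Bool → Bool) → ℝ, ∑ z : PairVec s, g z.1 =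
      ∑ z : Fin s × Bool → Bool,
        if ∀ k, ¬(z (k, false) = true ∧ z (k, true) = true) then g z else 0 := by
    intro g
    rw [← Finset.sum_filter]
    exact (Finset.sum_subtype _ (by simp) g).symm
  rw [h1 (fun z => if ∀ k c d, ¬((cond d b a).1 (k, c) = true ∧ z (e k c, d) = true) then
    (1 : ℝ) else 0), ← (pairEquiv s).symm.sum_comp, Fintype.sum_prod_type_right]
  simp only [bondTransfer, Matrix.mul_apply, Matrix.transpose_apply, Finset.sum_mul]
  refine Finset.sum_congr rfl fun w' _ => Finset.sum_congr rfl fun w _ => ?_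
  simp only [bondStep, orthStep, pairEquiv, Equiv.coe_fn_symm_mk, cond_true, cond_false,
    Bool.forall_bool, forall_and, mul_ite, mul_one, mul_zero, ← ite_and]
  congr 1
  refine propext ?_
  tauto

/-- The number of independent sets of the product of two systems of bonds. -/
def numConfig {r s r' s' : ℕ} (e : Fin r → Bool → Fin s) (e' : Fin r' → Bool → Fin s') : ℕ :=
  Fintype.card {x : (Fin s' → PairVec r) × (Fin s → PairVec r') //
    ∀ k b l c, ¬((x.1 (e' l c)).1 (k, b) = true ∧ (x.2 (e k b)).1 (l, c) = true)}

theorem numConfig_comm {r s r' s' : ℕ} (e : Fin r → Bool → Fin s) (e' : Fin r' → Bool → Fin s') :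
    numConfig e e' = numConfig e' e :=
  Fintype.card_congr ((Equiv.prodComm _ _).subtypeEquiv fun _ =>
    ⟨fun h k b l c hx => h l c k b hx.symm, fun h k b l c hx => h l c k b hx.symm⟩)

/-- Interchange of the two indices of a family of pair vectors. -/
def pairVecSwap (r s : ℕ) : (Fin r → PairVec s) ≃ (Fin s → PairVec r) where
  toFun z i := ⟨fun x => (z x.1).1 (i, x.2), fun k => (z k).2 i⟩
  invFun z i := ⟨fun x => (z x.1).1 (i, x.2), fun k => (z k).2 i⟩
  left_inv _ := rfl
  right_inv _ := rfl

theorem sum_prod_bondTransfer {r s r' s' : ℕ} (e : Fin r → Bool → Fin s)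
    (e' : Fin r' → Bool → Fin s') :
    ∑ x : Fin s' → PairVec r, ∏ l, bondTransfer e (x (e' l false)) (x (e' l true)) =
      (numConfig e e' : ℝ) := by
  simp only [bondTransfer_apply, Finset.prod_univ_sum, Fintype.piFinset_univ]
  rw [numConfig, Fintype.card_subtype, Finset.natCast_card_filter, Fintype.sum_prod_type]
  refine Finset.sum_congr rfl fun x _ => ?_
  rw [← (pairVecSwap r' s).sum_comp]
  refine Finset.sum_congr rfl fun z _ => ?_
  rw [Finset.prod_ite_zero]
  simp only [Finset.prod_const_one, Finset.mem_univ, true_implies]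
  congr 1
  refine propext ⟨fun h k b l c => ?_, fun h l k b c => ?_⟩
  · have := h l k b c
    cases c <;> exact this
  · have := h k b l c
    cases c <;> exact this

section Paths
variable {ι : Type*} [Fintype ι]

theorem sum_fin_succ_pi {n : ℕ} (F : (Fin (n + 1) → ι) → ℝ) :
    ∑ x, F x = ∑ u, ∑ x : Fin n → ι, F (Fin.cons u x) := by
  rw [← Fintype.sum_prod_type' fun u (x : Fin n → ι) => F (Fin.cons u x)]
  exact ((Fin.consEquiv fun _ : Fin (n + 1) => ι).sum_comp F).symm

variable [DecidableEq ι] (M : Matrix ι ι ℝ)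

theorem sum_path_from (g : ι → ℝ) (n : ℕ) (u : ι) :
    ∑ x : Fin n → ι, (∏ i : Fin n, M ((Fin.cons u x : Fin (n + 1) → ι) i.castSucc) (x i)) *
      g ((Fin.cons u x : Fin (n + 1) → ι) (Fin.last n)) = ∑ v, (M ^ n) u v * g v := by
  induction n generalizing u with
  | zero => simp [Matrix.one_apply]
  | succ n ih =>
    rw [sum_fin_succ_pi]
    simp only [pow_succ', Matrix.mul_apply, Finset.sum_mul]
    conv_rhs => rw [Finset.sum_comm]
    refine Finset.sum_congr rfl fun w _ => ?_
    simp only [mul_assoc]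
    rw [← Finset.mul_sum, ← ih w, Finset.mul_sum]
    refine Finset.sum_congr rfl fun x _ => ?_
    rw [Fin.prod_univ_succ, mul_assoc]
    rfl

theorem sum_path (n : ℕ) :
    ∑ x : Fin (n + 1) → ι, ∏ i : Fin n, M (x i.castSucc) (x i.succ) =
      ∑ u, ∑ v, (M ^ n) u v := by
  rw [sum_fin_succ_pi]
  refine Finset.sum_congr rfl fun u _ => ?_
  have := sum_path_from M (fun _ => 1) n u
  simp only [mul_one] at this
  rw [← this]
  rfl

theorem sum_cycle (n : ℕ) :
    ∑ x : Fin (n + 1) → ι, ∏ i : Fin (n + 1), M (x i) (x (i + 1)) = (M ^ (n + 1)).trace := by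
  rw [sum_fin_succ_pi, Matrix.trace]
  refine Finset.sum_congr rfl fun u _ => ?_
  rw [Matrix.diag_apply, pow_succ, Matrix.mul_apply, ← sum_path_from M (fun v => M v u) n u]
  refine Finset.sum_congr rfl fun x _ => ?_
  rw [Fin.prod_univ_castSucc]
  simp only [Fin.coeSucc_eq_succ, Fin.last_add_one]
  rfl

end Paths

theorem numConfig_path {r s : ℕ} (e : Fin r → Bool → Fin s) {n : ℕ} (hn : 1 ≤ n) :
    (numConfig e (pathEnd n) : ℝ) = ∑ u, ∑ v, (bondTransfer e ^ (n - 1)) u v := by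
  obtain ⟨n, rfl⟩ := Nat.exists_eq_add_of_le' hn
  rw [← sum_prod_bondTransfer]
  exact sum_path (bondTransfer e) n

theorem numConfig_ring {r s : ℕ} (e : Fin r → Bool → Fin s) {c : ℕ} (hc : 1 ≤ c) :
    (numConfig e (ringEnd c) : ℝ) = (bondTransfer e ^ c).trace := by
  obtain ⟨c, rfl⟩ := Nat.exists_eq_add_of_le' hc
  rw [← sum_prod_bondTransfer, ← sum_cycle]
  refine Finset.sum_congr rfl fun x _ => Finset.prod_congr rfl fun i _ => ?_
  congr 2
  · exact Fin.ext (Nat.mod_eq_of_lt i.isLt)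
  · refine Fin.ext ?_
    simp [ringEnd, Fin.val_add]

theorem numIndep_eq (m n : ℕ) : numIndep m n = numConfig (pathEnd m) (pathEnd n) := by
  classical
  rw [numIndep, numConfig, ← Nat.card_eq_fintype_card]
  refine Nat.card_congr
    { toFun := fun S => ⟨(fun j => ⟨fun x => decide (.inr (x.1, j, x.2) ∈ S.1), ?_⟩,
        fun i => ⟨fun x => decide (.inl (i, x.1, x.2) ∈ S.1), ?_⟩), ?_⟩
      invFun := fun x => ⟨{u | Sum.elim (fun h => (x.1.2 h.1).1 (h.2.1, h.2.2) = true)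
        (fun v => (x.1.1 v.2.1).1 (v.1, v.2.2) = true) u}, ?_⟩
      left_inv := ?_
      right_inv := ?_ }
  · intro k h
    simp only [decide_eq_true_eq] at h
    exact S.2 h.1 h.2 (by simp) (by simp [graph, Adj884])
  · intro k h
    simp only [decide_eq_true_eq] at h
    exact S.2 h.1 h.2 (by simp) (by simp [graph, Adj884])
  · intro k b l c h
    simp only [decide_eq_true_eq] at h
    exact S.2 h.1 h.2 (by simp) (by simp [graph, Adj884, hCell, vCell, pathEnd])
  · have hh : ∀ (i : Fin m) (l : Fin (n - 1)) (b c : Bool), b ≠ c →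
        (x.1.2 i).1 (l, b) = true → (x.1.2 i).1 (l, c) = true → False := by
      intro i l b c hbc h1 h2
      have := (x.1.2 i).2 l
      cases b <;> cases c <;> simp_all
    have hv : ∀ (i : Fin n) (l : Fin (m - 1)) (b c : Bool), b ≠ c →
        (x.1.1 i).1 (l, b) = true → (x.1.1 i).1 (l, c) = true → False := by
      intro i l b c hbc h1 h2
      have := (x.1.1 i).2 l
      cases b <;> cases c <;> simp_all
    have hx : ∀ (h : Fin m × Fin (n - 1) × Bool) (v : Fin (m - 1) × Fin n × Bool),
        hCell h = vCell v → (x.1.2 h.1).1 (h.2.1, h.2.2) = true →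
        (x.1.1 v.2.1).1 (v.1, v.2.2) = true → False := by
      rintro ⟨i, l, c⟩ ⟨k, j, b⟩ he h1 h2
      simp only [hCell, vCell, Prod.mk.injEq] at he
      have hi : i = pathEnd m k b := Fin.ext he.1
      have hj : j = pathEnd n l c := Fin.ext he.2.symm
      subst hi hj
      exact x.2 k b l c ⟨h2, h1⟩
    rintro (⟨i, l, b⟩ | ⟨k, j, b⟩) h1 (⟨i', l', b'⟩ | ⟨k', j', b'⟩) h2 - h3
    · obtain ⟨rfl, rfl, hb⟩ : i = i' ∧ l = l' ∧ b ≠ b' := h3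
      exact hh _ _ _ _ hb h1 h2
    · exact hx _ _ h3 h1 h2
    · exact hx _ _ h3 h2 h1
    · obtain ⟨rfl, rfl, hb⟩ : k = k' ∧ j = j' ∧ b ≠ b' := h3
      exact hv _ _ _ _ hb h1 h2
  · intro S
    ext (u | u) <;> simp
  · intro x
    simp

theorem numIndep_comm (m n : ℕ) : numIndep m n = numIndep n m := by
  rw [numIndep_eq, numIndep_eq, numConfig_comm]

theorem numIndep_eq_sum (m : ℕ) {n : ℕ} (hn : 1 ≤ n) :
    (numIndep m n : ℝ) = ∑ u, ∑ v, (planeTransfer m ^ (n - 1)) u v := by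
  rw [numIndep_eq, numConfig_path _ hn, planeTransfer_eq]

theorem trace_planeTransfer_pow {m c : ℕ} (hm : 1 ≤ m) (hc : 1 ≤ c) :
    (planeTransfer m ^ c).trace = ∑ u, ∑ v, (cylTransfer c ^ (m - 1)) u v := by
  rw [planeTransfer_eq, ← numConfig_ring _ hc, numConfig_comm, numConfig_path _ hm,
    cylTransfer_eq]

theorem card_vert {m n : ℕ} (hm : 1 ≤ m) (hn : 1 ≤ n) :
    (Fintype.card (Vert m n) : ℤ) = 4 * m * n - 2 * m - 2 * n := by
  simp only [Vert, Fintype.card_sum, Fintype.card_prod, Fintype.card_fin, Fintype.card_bool]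
  push_cast [Nat.cast_sub hm, Nat.cast_sub hn]
  ring

end Lattice884

namespace Lattice884

section Spectral
variable {ι : Type} [Fintype ι] [DecidableEq ι] {A : Matrix ι ι ℝ}

/-- Orthogonal diagonalisation of a real symmetric matrix and of its powers. -/
theorem exists_diagonalisation (hA : A.IsSymm) :
    ∃ (l : ι → ℝ) (U : ι → ι → ℝ), spectrum ℝ A = Set.range l ∧
      (∀ i, ∑ u, U u i ^ 2 = 1) ∧
      ∀ n u v, (A ^ n) u v = ∑ i, l i ^ n * (U u i * U v i) := by
  have hH : A.IsHermitian := by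
    rw [Matrix.IsHermitian, Matrix.conjTranspose_eq_transpose_of_trivial]; exact hA
  refine ⟨hH.eigenvalues, fun u i => hH.eigenvectorBasis i u,
    hH.spectrum_real_eq_range_eigenvalues, fun i => ?_, fun n u v => ?_⟩
  · have h := hH.eigenvectorBasis.orthonormal.1 i
    rw [EuclideanSpace.norm_eq, Real.sqrt_eq_one] at h
    simpa using h
  · conv_lhs => rw [hH.spectral_theorem]
    rw [← map_pow, Matrix.diagonal_pow, Unitary.conjStarAlgAut_apply]
    simp only [Matrix.mul_apply, Matrix.diagonal_apply, Matrix.star_apply,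
      mul_ite, mul_zero, Finset.sum_ite_eq', Finset.mem_univ, if_true,
      Matrix.IsHermitian.eigenvectorUnitary_apply]
    refine Finset.sum_congr rfl fun i _ => ?_
    simp
    ring

theorem maxEigenvalue_eq {l : ι → ℝ} [Nonempty ι] (hl : spectrum ℝ A = Set.range l) :
    (∀ i, l i ≤ maxEigenvalue A) ∧ ∃ i, l i = maxEigenvalue A := by
  have hf := Set.finite_range l
  rw [maxEigenvalue, hl]
  exact ⟨fun i => le_csSup hf.bddAbove ⟨i, rfl⟩, (Set.range_nonempty l).csSup_mem hf⟩

theorem sum_pow_eq {l : ι → ℝ} {U : ι → ι → ℝ}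
    (hU : ∀ n u v, (A ^ n) u v = ∑ i, l i ^ n * (U u i * U v i)) (n : ℕ) (x : ι → ℝ) :
    ∑ u, ∑ v, x u * (A ^ n) u v * x v = ∑ i, l i ^ n * (∑ u, x u * U u i) ^ 2 := by
  simp only [hU, sq, Finset.mul_sum, Finset.sum_mul]
  rw [Finset.sum_congr rfl fun u _ => Finset.sum_comm, Finset.sum_comm]
  refine Finset.sum_congr rfl fun i _ => ?_
  rw [Finset.sum_comm]
  exact Finset.sum_congr rfl fun u _ => Finset.sum_congr rfl fun v _ => by ring

theorem rayleigh_le [Nonempty ι] (hA : A.IsSymm) (x : ι → ℝ) :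
    ∑ u, ∑ v, x u * A u v * x v ≤ maxEigenvalue A * ∑ u, x u ^ 2 := by
  obtain ⟨l, U, hl, -, hU⟩ := exists_diagonalisation hA
  have h1 := sum_pow_eq hU 1 x
  have h0 := sum_pow_eq hU 0 x
  simp only [pow_one, pow_zero, Matrix.one_apply, one_mul, mul_ite, mul_one, mul_zero, ite_mul,
    zero_mul, Finset.sum_ite_eq, Finset.mem_univ, if_true] at h1 h0
  simp only [h1, sq (x _), h0, Finset.mul_sum]
  exact Finset.sum_le_sum fun i _ =>
    mul_le_mul_of_nonneg_right ((maxEigenvalue_eq hl).1 i) (sq_nonneg _)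

theorem pow_entry_nonneg (h0 : ∀ u v, 0 ≤ A u v) (n : ℕ) : ∀ u v, 0 ≤ (A ^ n) u v := by
  induction n with
  | zero => intro u v; rw [pow_zero, Matrix.one_apply]; split <;> norm_num
  | succ n ih =>
    intro u v
    rw [pow_succ, Matrix.mul_apply]
    exact Finset.sum_nonneg fun w _ => mul_nonneg (ih u w) (h0 w v)

theorem sum_mul_le_sum_abs (n : ℕ) (h0 : ∀ u v, 0 ≤ A u v) (x : ι → ℝ) :
    |∑ u, ∑ v, x u * (A ^ n) u v * x v| ≤ ∑ u, ∑ v, |x u| * (A ^ n) u v * |x v| := by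
  refine (Finset.abs_sum_le_sum_abs _ _).trans (Finset.sum_le_sum fun u _ => ?_)
  refine (Finset.abs_sum_le_sum_abs _ _).trans (Finset.sum_le_sum fun v _ => ?_)
  rw [abs_mul, abs_mul, abs_of_nonneg (pow_entry_nonneg h0 n u v)]

/-- Perron–Frobenius data of a nonnegative symmetric matrix. -/
theorem exists_nonneg_diagonalisation [Nonempty ι] (hA : A.IsSymm) (h0 : ∀ u v, 0 ≤ A u v) :
    ∃ (l : ι → ℝ) (U : ι → ι → ℝ), (∀ i, |l i| ≤ maxEigenvalue A) ∧
      (∃ i, l i = maxEigenvalue A) ∧ (∀ i, ∑ u, U u i ^ 2 = 1) ∧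
      (∀ n u v, (A ^ n) u v = ∑ i, l i ^ n * (U u i * U v i)) ∧
      ∀ n i, ∑ u, ∑ v, U u i * (A ^ n) u v * U v i = l i ^ n := by
  obtain ⟨l, U, hl, hn, hU⟩ := exists_diagonalisation hA
  have horth : ∀ i j, i ≠ j → ∑ u, U u j * U u i = 0 := by
    intro i j hij
    have h := sum_pow_eq hU 0 fun u => U u j
    simp only [pow_zero, Matrix.one_apply, one_mul, mul_ite, mul_one, mul_zero, ite_mul,
      zero_mul, Finset.sum_ite_eq, Finset.mem_univ, if_true] at h
    have hj : ∑ u, U u j * U u j = 1 := by simpa only [sq] using hn j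
    rw [hj, ← Finset.add_sum_erase _ _ (Finset.mem_univ j), hj] at h
    have h' : ∑ k ∈ Finset.univ.erase j, (∑ u, U u j * U u k) ^ 2 = 0 := by linarith
    rw [Finset.sum_eq_zero_iff_of_nonneg fun _ _ => sq_nonneg _] at h'
    exact pow_eq_zero_iff two_ne_zero |>.1 (h' i (by simp [hij]))
  have hq : ∀ n i, ∑ u, ∑ v, U u i * (A ^ n) u v * U v i = l i ^ n := by
    intro n i
    rw [sum_pow_eq hU n fun u => U u i, Finset.sum_eq_single i]
    · simp only [← sq]
      rw [hn i]; ring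
    · intro j _ hj
      rw [horth j i hj]; ring
    · simp
  refine ⟨l, U, fun i => ?_, (maxEigenvalue_eq hl).2, hn, hU, hq⟩
  have h1 := sum_mul_le_sum_abs 1 h0 fun u => U u i
  rw [hq 1 i] at h1
  simp only [pow_one] at h1
  refine h1.trans ((rayleigh_le hA fun u => |U u i|).trans_eq ?_)
  simp [sq_abs, hn i]

theorem maxEigenvalue_nonneg [Nonempty ι] (hA : A.IsSymm) (h0 : ∀ u v, 0 ≤ A u v) :
    0 ≤ maxEigenvalue A := by
  obtain ⟨l, U, hl, ⟨i, -⟩, -⟩ := exists_nonneg_diagonalisation hA h0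
  exact (abs_nonneg _).trans (hl i)

/-- The sum of the entries of a matrix. -/
def entrySum (A : Matrix ι ι ℝ) : ℝ := ∑ u, ∑ v, A u v

theorem entrySum_pow_eq {l : ι → ℝ} {U : ι → ι → ℝ}
    (hU : ∀ n u v, (A ^ n) u v = ∑ i, l i ^ n * (U u i * U v i)) (n : ℕ) :
    entrySum (A ^ n) = ∑ i, l i ^ n * (∑ u, U u i) ^ 2 := by
  simpa [entrySum] using sum_pow_eq hU n fun _ => 1

theorem maxEigenvalue_pow_le_entrySum [Nonempty ι] (hA : A.IsSymm) (h0 : ∀ u v, 0 ≤ A u v)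
    (n : ℕ) : maxEigenvalue A ^ n ≤ entrySum (A ^ n) := by
  obtain ⟨l, U, hl, ⟨i, hi⟩, hn, hU, hq⟩ := exists_nonneg_diagonalisation hA h0
  have hU1 : ∀ u, |U u i| ≤ 1 := by
    intro u
    rw [← sq_le_one_iff_abs_le_one, ← hn i]
    exact Finset.single_le_sum (f := fun u => U u i ^ 2) (fun _ _ => sq_nonneg _)
      (Finset.mem_univ u)
  rw [← hi, ← hq n i]
  refine (le_abs_self _).trans ((sum_mul_le_sum_abs n h0 _).trans ?_)
  refine Finset.sum_le_sum fun u _ => Finset.sum_le_sum fun v _ => ?_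
  have hp := pow_entry_nonneg h0 n u v
  calc |U u i| * (A ^ n) u v * |U v i| ≤ 1 * (A ^ n) u v * 1 :=
        mul_le_mul (mul_le_mul_of_nonneg_right (hU1 u) hp) (hU1 v) (abs_nonneg _) (by simpa)
    _ = (A ^ n) u v := by ring

theorem entrySum_pow_add_le [Nonempty ι] (hA : A.IsSymm) (h0 : ∀ u v, 0 ≤ A u v) (p q : ℕ) :
    entrySum (A ^ (p + 2 * q)) ≤ maxEigenvalue A ^ p * entrySum (A ^ (2 * q)) := by
  obtain ⟨l, U, hl, -, -, hU, -⟩ := exists_nonneg_diagonalisation hA h0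
  rw [entrySum_pow_eq hU, entrySum_pow_eq hU, Finset.mul_sum]
  refine Finset.sum_le_sum fun i _ => ?_
  rw [← mul_assoc, pow_add]
  refine mul_le_mul_of_nonneg_right (mul_le_mul_of_nonneg_right ?_ ?_) (sq_nonneg _)
  · exact (le_abs_self _).trans (by rw [abs_pow]; exact pow_le_pow_left₀ (abs_nonneg _) (hl i) p)
  · rw [pow_mul']; exact sq_nonneg _

theorem entrySum_pow_le [Nonempty ι] (hA : A.IsSymm) (h0 : ∀ u v, 0 ≤ A u v) (n : ℕ) :
    entrySum (A ^ n) ≤ Fintype.card ι * maxEigenvalue A ^ n := by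
  have := entrySum_pow_add_le hA h0 n 0
  rw [mul_zero, add_zero, pow_zero, entrySum] at this
  simpa [entrySum, Matrix.one_apply, mul_comm] using this

theorem maxEigenvalue_pow_le_trace [Nonempty ι] (hA : A.IsSymm) (h0 : ∀ u v, 0 ≤ A u v) (k : ℕ) :
    maxEigenvalue A ^ (2 * k) ≤ (A ^ (2 * k)).trace := by
  obtain ⟨l, U, hl, ⟨i, hi⟩, hn, hU, hq⟩ := exists_nonneg_diagonalisation hA h0
  have : (A ^ (2 * k)).trace = ∑ i, l i ^ (2 * k) := by
    simp only [Matrix.trace, Matrix.diag_apply, hU]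
    rw [Finset.sum_comm]
    simp only [← Finset.mul_sum, ← sq, hn, mul_one]
  rw [this, ← hi]
  exact Finset.single_le_sum (f := fun i => l i ^ (2 * k))
    (fun j _ => by rw [pow_mul']; exact sq_nonneg _) (Finset.mem_univ i)

theorem le_of_forall_pow_le {a b C : ℝ} (hb : 0 ≤ b)
    (h : ∀ n : ℕ, a ^ n ≤ C * b ^ n) : a ≤ b := by
  by_contra! hab
  rcases hb.eq_or_lt with rfl | hb
  · have := h 1
    simp only [pow_one, mul_zero] at this
    linarith
  obtain ⟨n, hn⟩ := pow_unbounded_of_one_lt C ((one_lt_div hb).2 hab)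
  rw [div_pow, lt_div_iff₀ (pow_pos hb n)] at hn
  exact (h n).not_gt hn

/-- The Collatz–Wielandt upper bound. -/
theorem maxEigenvalue_le_of_supersolution [Nonempty ι] (hA : A.IsSymm) (h0 : ∀ u v, 0 ≤ A u v)
    {y : ι → ℝ} (hy : ∀ u, 0 < y u) {μ : ℝ} (h : ∀ u, ∑ v, A u v * y v ≤ μ * y u) :
    maxEigenvalue A ≤ μ := by
  have hμ : 0 ≤ μ := by
    obtain ⟨u⟩ := ‹Nonempty ι›
    have : 0 ≤ μ * y u :=
      (Finset.sum_nonneg fun v _ => mul_nonneg (h0 u v) (hy v).le).trans (h u)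
    exact nonneg_of_mul_nonneg_left this (hy u)
  have hpow : ∀ n u, ∑ v, (A ^ n) u v * y v ≤ μ ^ n * y u := by
    intro n
    induction n with
    | zero => intro u; simp [Matrix.one_apply]
    | succ n ih =>
      intro u
      calc ∑ v, (A ^ (n + 1)) u v * y v = ∑ w, A u w * ∑ v, (A ^ n) w v * y v := by
            simp only [pow_succ', Matrix.mul_apply, Finset.sum_mul, Finset.mul_sum]
            rw [Finset.sum_comm]
            simp only [mul_assoc]
        _ ≤ ∑ w, A u w * (μ ^ n * y w) :=
            Finset.sum_le_sum fun w _ => mul_le_mul_of_nonneg_left (ih w) (h0 u w)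
        _ = μ ^ n * ∑ w, A u w * y w := by
            rw [Finset.mul_sum]; exact Finset.sum_congr rfl fun w _ => by ring
        _ ≤ μ ^ n * (μ * y u) := mul_le_mul_of_nonneg_left (h u) (pow_nonneg hμ n)
        _ = μ ^ (n + 1) * y u := by ring
  obtain ⟨w, hw⟩ := Finite.exists_min y
  refine le_of_forall_pow_le (C := (∑ u, y u) / y w) hμ fun n => ?_
  refine (maxEigenvalue_pow_le_entrySum hA h0 n).trans ?_
  rw [div_mul_eq_mul_div, le_div_iff₀ (hy w), entrySum, Finset.sum_mul, Finset.sum_mul]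
  refine Finset.sum_le_sum fun u _ => ?_
  rw [mul_comm (y u)]
  refine le_trans ?_ (hpow n u)
  rw [Finset.sum_mul]
  exact Finset.sum_le_sum fun v _ =>
    mul_le_mul_of_nonneg_left (hw v) (pow_entry_nonneg h0 n u v)

end Spectral

end Lattice884

namespace Lattice884

/-- A pair vector as a family of pairs. -/
def pairVecEquiv (r : ℕ) :
    PairVec r ≃ (Fin r → {p : Bool → Bool // ¬(p false = true ∧ p true = true)}) where
  toFun v k := ⟨fun b => v.1 (k, b), v.2 k⟩
  invFun w := ⟨fun x => (w x.1).1 x.2, fun k => (w k).2⟩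
  left_inv _ := rfl
  right_inv _ := rfl

theorem card_pairVec (r : ℕ) : Fintype.card (PairVec r) = 3 ^ r := by
  rw [Fintype.card_congr (pairVecEquiv r), Fintype.card_fun, Fintype.card_fin]
  rfl

instance (r : ℕ) : Nonempty (PairVec r) := ⟨⟨fun _ => false, by simp⟩⟩

section Bonds
variable {r s : ℕ} (e : Fin r → Bool → Fin s)

theorem one_le_bondTransfer (a b : PairVec r) : 1 ≤ bondTransfer e a b := by
  rw [bondTransfer_apply]
  refine le_trans (le_of_eq ?_) (Finset.single_le_sum (fun z _ => by split <;> norm_num)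
    (Finset.mem_univ (⟨fun _ => false, by simp⟩ : PairVec s)))
  simp

theorem bondTransfer_le (a b : PairVec r) : bondTransfer e a b ≤ 3 ^ s := by
  rw [bondTransfer_apply]
  refine (Finset.sum_le_card_nsmul _ _ 1 fun z _ => by split <;> norm_num).trans_eq ?_
  rw [Finset.card_univ, card_pairVec]
  simp

theorem bondTransfer_nonneg (a b : PairVec r) : 0 ≤ bondTransfer e a b :=
  zero_le_one.trans (one_le_bondTransfer e a b)

theorem entrySum_bondTransfer_pow_le (n : ℕ) :
    entrySum (bondTransfer e ^ n) ≤ 3 ^ r * maxEigenvalue (bondTransfer e) ^ n := by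
  have := entrySum_pow_le (bondTransfer_isSymm e) (bondTransfer_nonneg e) n
  rwa [card_pairVec, Nat.cast_pow, Nat.cast_ofNat] at this

theorem one_le_maxEigenvalue_bondTransfer : 1 ≤ maxEigenvalue (bondTransfer e) := by
  refine le_of_forall_pow_le (C := 3 ^ r)
    (maxEigenvalue_nonneg (bondTransfer_isSymm e) (bondTransfer_nonneg e)) fun n => ?_
  rw [one_pow]
  refine le_trans ?_ (entrySum_bondTransfer_pow_le e n)
  have h1 : ∀ u v, (1 : Matrix (PairVec r) (PairVec r) ℝ) u v ≤ 1 := by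
    intro u v; rw [Matrix.one_apply]; split <;> norm_num
  have h : ∀ u, 1 ≤ (bondTransfer e ^ n) u u := by
    intro u
    induction n with
    | zero => simp
    | succ n ih =>
      rw [pow_succ, Matrix.mul_apply]
      refine le_trans (one_le_mul_of_one_le_of_one_le ih (one_le_bondTransfer e u u))
        (Finset.single_le_sum (f := fun w => (bondTransfer e ^ n) u w * bondTransfer e w u)
          (fun w _ => mul_nonneg (pow_entry_nonneg (bondTransfer_nonneg e) n u w)
            (bondTransfer_nonneg e w u)) (Finset.mem_univ u))
  obtain ⟨u⟩ := (inferInstance : Nonempty (PairVec r))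
  have hp := pow_entry_nonneg (bondTransfer_nonneg e) n
  calc 1 ≤ (bondTransfer e ^ n) u u := h u
    _ ≤ ∑ v, (bondTransfer e ^ n) u v :=
      Finset.single_le_sum (fun v _ => hp u v) (Finset.mem_univ u)
    _ ≤ _ := Finset.single_le_sum (f := fun u => ∑ v, (bondTransfer e ^ n) u v)
      (fun u _ => Finset.sum_nonneg fun v _ => hp u v) (Finset.mem_univ u)

theorem entrySum_pow_add_one_add_le (a b : ℕ) :
    entrySum (bondTransfer e ^ (a + 1 + b)) ≤
      3 ^ s * (entrySum (bondTransfer e ^ a) * entrySum (bondTransfer e ^ b)) := by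
  set A := bondTransfer e
  have hp := pow_entry_nonneg (bondTransfer_nonneg e)
  have h : ∀ u v, (A ^ (a + 1 + b)) u v ≤
      3 ^ s * ((∑ w, (A ^ a) u w) * ∑ x, (A ^ b) x v) := by
    intro u v
    rw [pow_add, pow_succ, Matrix.mul_apply]
    simp only [Matrix.mul_apply, Finset.mul_sum, Finset.sum_mul]
    refine Finset.sum_le_sum fun x _ => Finset.sum_le_sum fun w _ => ?_
    calc (A ^ a) u w * A w x * (A ^ b) x v ≤ (A ^ a) u w * 3 ^ s * (A ^ b) x v :=
          mul_le_mul_of_nonneg_right (mul_le_mul_of_nonneg_left (bondTransfer_le e w x)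
            (hp a u w)) (hp b x v)
      _ = _ := by ring
  refine (Finset.sum_le_sum fun u _ => Finset.sum_le_sum fun v _ => h u v).trans_eq ?_
  simp only [← Finset.mul_sum, ← Finset.sum_mul, entrySum]
  rw [Finset.sum_comm (f := fun x v => (A ^ b) x v)]

end Bonds

/-- The largest eigenvalue of the plane transfer matrix with `m` rows. -/
noncomputable def planeEig (m : ℕ) : ℝ := maxEigenvalue (planeTransfer m)

theorem one_le_planeEig (m : ℕ) : 1 ≤ planeEig m := by
  rw [planeEig, planeTransfer_eq]; exact one_le_maxEigenvalue_bondTransfer _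

theorem planeEig_pos (m : ℕ) : 0 < planeEig m := zero_lt_one.trans_le (one_le_planeEig m)

theorem numIndep_eq_entrySum (m n : ℕ) :
    (numIndep m (n + 1) : ℝ) = entrySum (bondTransfer (pathEnd m) ^ n) := by
  rw [numIndep_eq_sum m (Nat.succ_pos n), planeTransfer_eq]; rfl

theorem planeEig_pow_le (m n : ℕ) : planeEig m ^ n ≤ numIndep m (n + 1) := by
  rw [numIndep_eq_entrySum, planeEig, planeTransfer_eq]
  exact maxEigenvalue_pow_le_entrySum (bondTransfer_isSymm _) (bondTransfer_nonneg _) n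

theorem numIndep_le (m n : ℕ) : (numIndep m (n + 1) : ℝ) ≤ 3 ^ (m - 1) * planeEig m ^ n := by
  rw [numIndep_eq_entrySum, planeEig, planeTransfer_eq]
  exact entrySum_bondTransfer_pow_le _ n

theorem numIndep_add_le (m a b : ℕ) :
    (numIndep m (a + 1 + (b + 1)) : ℝ) ≤
      3 ^ m * (numIndep m (a + 1) * numIndep m (b + 1)) := by
  rw [show a + 1 + (b + 1) = a + 1 + b + 1 by ring]
  simp only [numIndep_eq_entrySum]
  exact entrySum_pow_add_one_add_le _ a b

theorem planeEig_add_le {a b : ℕ} (ha : 1 ≤ a) (hb : 1 ≤ b) :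
    planeEig (a + b) ≤ 3 * (planeEig a * planeEig b) := by
  obtain ⟨a, rfl⟩ := Nat.exists_eq_add_of_le' ha
  obtain ⟨b, rfl⟩ := Nat.exists_eq_add_of_le' hb
  have h3 : 0 ≤ 3 * (planeEig (a + 1) * planeEig (b + 1)) := by
    have := planeEig_pos (a + 1)
    have := planeEig_pos (b + 1)
    positivity
  refine le_of_forall_pow_le (C := 3 * (3 ^ a * 3 ^ b)) h3 fun n => ?_
  calc planeEig (a + 1 + (b + 1)) ^ n ≤ numIndep (a + 1 + (b + 1)) (n + 1) := planeEig_pow_le _ n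
    _ = numIndep (n + 1) (a + 1 + (b + 1)) := by rw [numIndep_comm]
    _ ≤ 3 ^ (n + 1) * (numIndep (n + 1) (a + 1) * numIndep (n + 1) (b + 1)) :=
      numIndep_add_le _ a b
    _ = 3 ^ (n + 1) * (numIndep (a + 1) (n + 1) * numIndep (b + 1) (n + 1)) := by
      rw [numIndep_comm, numIndep_comm (n + 1)]
    _ ≤ 3 ^ (n + 1) * ((3 ^ a * planeEig (a + 1) ^ n) * (3 ^ b * planeEig (b + 1) ^ n)) := by
      gcongr
      · have := planeEig_pos (a + 1)
        positivity
      · exact numIndep_le (a + 1) n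
      · exact numIndep_le (b + 1) n
    _ = _ := by rw [mul_pow, mul_pow]; ring

theorem exists_tendsto_log_planeEig :
    ∃ l : ℝ, Tendsto (fun m : ℕ => Real.log (planeEig m) / m) atTop (𝓝 l) := by
  let u : ℕ → ℝ := fun m => if m = 0 then 0 else Real.log 3 + Real.log (planeEig m)
  have h3 : 0 ≤ Real.log 3 := Real.log_nonneg (by norm_num)
  have hl : ∀ m, 0 ≤ Real.log (planeEig m) := fun m => Real.log_nonneg (one_le_planeEig m)
  have hu : Subadditive u := by
    intro a b
    rcases Nat.eq_zero_or_pos a with rfl | ha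
    · simp [u]
    rcases Nat.eq_zero_or_pos b with rfl | hb
    · simp [u]
    have h := Real.log_le_log (planeEig_pos _) (planeEig_add_le ha hb)
    rw [Real.log_mul (by norm_num) (mul_pos (planeEig_pos a) (planeEig_pos b)).ne',
      Real.log_mul (planeEig_pos a).ne' (planeEig_pos b).ne'] at h
    simp only [u, show a + b ≠ 0 by omega, ha.ne', hb.ne', if_false]
    linarith
  have hb : BddBelow (Set.range fun n : ℕ => u n / n) := by
    refine ⟨0, ?_⟩
    rintro _ ⟨n, rfl⟩
    refine div_nonneg ?_ n.cast_nonneg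
    simp only [u]
    split
    · exact le_rfl
    · exact add_nonneg h3 (hl n)
  refine ⟨hu.lim, ?_⟩
  have h1 := (hu.tendsto_lim hb).sub (tendsto_const_div_atTop_nhds_zero_nat (Real.log 3))
  rw [sub_zero] at h1
  refine h1.congr' ?_
  filter_upwards [eventually_ge_atTop 1] with m hm
  simp only [u, show m ≠ 0 by omega, if_false]
  ring

theorem numIndep_pos (m : ℕ) {n : ℕ} (hn : 1 ≤ n) : (0 : ℝ) < numIndep m n := by
  obtain ⟨n, rfl⟩ := Nat.exists_eq_add_of_le' hn
  exact (pow_pos (planeEig_pos m) n).trans_le (planeEig_pow_le m n)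

theorem log_numIndep_bounds {m n : ℕ} (hm : 1 ≤ m) (hn : 1 ≤ n) :
    (n - 1 : ℝ) * Real.log (planeEig m) ≤ Real.log (numIndep m n) ∧
      Real.log (numIndep m n) ≤ (m - 1 : ℝ) * Real.log 3 + (n - 1 : ℝ) * Real.log (planeEig m) := by
  obtain ⟨n, rfl⟩ := Nat.exists_eq_add_of_le' hn
  have hp := planeEig_pos m
  have h1 := Real.log_le_log (pow_pos hp n) (planeEig_pow_le m n)
  have h2 := Real.log_le_log (numIndep_pos m hn) (numIndep_le m n)
  rw [Real.log_mul (by positivity) (by positivity), Real.log_pow, Real.log_pow] at h2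
  rw [Real.log_pow] at h1
  push_cast [Nat.cast_sub hm] at h1 h2 ⊢
  constructor <;> linarith

theorem tendsto_one_sub_inv : Tendsto (fun n : ℕ => 1 - 1 / (n : ℝ)) atTop (𝓝 1) := by
  simpa using tendsto_const_nhds.sub (tendsto_const_div_atTop_nhds_zero_nat (1 : ℝ))

theorem tendsto_log_numIndep {l : ℝ}
    (hl : Tendsto (fun m : ℕ => Real.log (planeEig m) / m) atTop (𝓝 l)) :
    Tendsto (fun p : ℕ × ℕ => Real.log (numIndep p.1 p.2) / ((p.1 : ℝ) * p.2))
      (atTop ×ˢ atTop) (𝓝 l) := by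
  have h1 : Tendsto (fun p : ℕ × ℕ => Real.log (planeEig p.1) / p.1 * (1 - 1 / (p.2 : ℝ)))
      (atTop ×ˢ atTop) (𝓝 l) := by
    simpa using (hl.comp tendsto_fst).mul (tendsto_one_sub_inv.comp tendsto_snd)
  have h2 : Tendsto (fun p : ℕ × ℕ => Real.log (planeEig p.1) / p.1 * (1 - 1 / (p.2 : ℝ)) +
      Real.log 3 / p.2) (atTop ×ˢ atTop) (𝓝 l) := by
    simpa using h1.add
      ((tendsto_const_div_atTop_nhds_zero_nat (Real.log 3)).comp tendsto_snd)
  have hev : ∀ᶠ p : ℕ × ℕ in atTop ×ˢ atTop, 1 ≤ p.1 ∧ 1 ≤ p.2 :=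
    (eventually_ge_atTop 1).prod_mk (eventually_ge_atTop 1)
  refine tendsto_of_tendsto_of_tendsto_of_le_of_le' h1 h2 ?_ ?_
  · filter_upwards [hev] with p hp
    have hm : (1 : ℝ) ≤ p.1 := by exact_mod_cast hp.1
    have hn : (1 : ℝ) ≤ p.2 := by exact_mod_cast hp.2
    have h := (log_numIndep_bounds hp.1 hp.2).1
    rw [le_div_iff₀ (by positivity)]
    refine le_trans (le_of_eq ?_) h
    field_simp
  · filter_upwards [hev] with p hp
    have hm : (1 : ℝ) ≤ p.1 := by exact_mod_cast hp.1
    have hn : (1 : ℝ) ≤ p.2 := by exact_mod_cast hp.2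
    have h := (log_numIndep_bounds hp.1 hp.2).2
    rw [div_le_iff₀ (by positivity)]
    have h3 : 0 ≤ Real.log 3 := Real.log_nonneg (by norm_num)
    refine h.trans (le_trans ?_ (le_of_eq (a := p.1 * Real.log 3 +
      (p.2 - 1 : ℝ) * Real.log (planeEig p.1)) ?_))
    · linarith
    · field_simp
      ring

theorem tendsto_numIndep_rpow {l : ℝ}
    (hl : Tendsto (fun m : ℕ => Real.log (planeEig m) / m) atTop (𝓝 l)) :
    Tendsto (fun p : ℕ × ℕ => (numIndep p.1 p.2 : ℝ) ^ ((1 : ℝ) / ((p.1 : ℝ) * (p.2 : ℝ))))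
      (atTop ×ˢ atTop) (𝓝 (Real.exp l)) := by
  refine ((Real.continuous_exp.tendsto l).comp (tendsto_log_numIndep hl)).congr' ?_
  filter_upwards [(eventually_ge_atTop 1).prod_mk (eventually_ge_atTop 1)] with p hp
  rw [Real.rpow_def_of_pos (numIndep_pos _ hp.2), Function.comp, mul_one_div]

theorem tendsto_numIndep_rpow_card {l : ℝ}
    (hl : Tendsto (fun m : ℕ => Real.log (planeEig m) / m) atTop (𝓝 l)) :
    Tendsto (fun p : ℕ × ℕ => (numIndep p.1 p.2 : ℝ) ^
      ((1 : ℝ) / (Fintype.card (Vert p.1 p.2) : ℝ))) (atTop ×ˢ atTop) (𝓝 (Real.exp (l / 4))) := by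
  have hr : Tendsto (fun p : ℕ × ℕ => 4 - 2 / (p.2 : ℝ) - 2 / (p.1 : ℝ))
      (atTop ×ˢ atTop) (𝓝 4) := by
    simpa using (tendsto_const_nhds.sub
      ((tendsto_const_div_atTop_nhds_zero_nat (2 : ℝ)).comp tendsto_snd)).sub
      ((tendsto_const_div_atTop_nhds_zero_nat (2 : ℝ)).comp tendsto_fst)
  refine ((Real.continuous_exp.tendsto _).comp
    ((tendsto_log_numIndep hl).div hr (by norm_num))).congr' ?_
  filter_upwards [(eventually_ge_atTop 1).prod_mk (eventually_ge_atTop 1)] with p hp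
  have hm : (1 : ℝ) ≤ p.1 := by exact_mod_cast hp.1
  have hn : (1 : ℝ) ≤ p.2 := by exact_mod_cast hp.2
  have hc : (Fintype.card (Vert p.1 p.2) : ℝ) = 4 * p.1 * p.2 - 2 * p.1 - 2 * p.2 := by
    exact_mod_cast card_vert hp.1 hp.2
  rw [Real.rpow_def_of_pos (numIndep_pos _ hp.2), Function.comp, mul_one_div, hc]
  congr 1
  simp only [Pi.div_apply]
  rw [div_div]
  congr 1
  field_simp

theorem le_limit {l : ℝ} (hl : Tendsto (fun m : ℕ => Real.log (planeEig m) / m) atTop (𝓝 l))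
    {p : ℕ} (q : ℕ) (hp : 1 ≤ p) :
    (planeEig (p + 2 * q + 1) / planeEig (2 * q + 1)) ^ ((1 : ℝ) / (p : ℝ)) ≤ Real.exp l := by
  set R := Real.log (planeEig (p + 2 * q + 1)) - Real.log (planeEig (2 * q + 1)) with hR
  have hp' : (0 : ℝ) < p := by exact_mod_cast hp
  have key : ∀ m : ℕ, 1 ≤ m →
      (1 - 1 / (m : ℝ)) * R - (2 * q * Real.log 3) / m ≤ p * (Real.log (planeEig m) / m) := by
    intro m hm
    have hm' : (0 : ℝ) < m := by exact_mod_cast hm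
    have h : (numIndep m (p + 2 * q + 1) : ℝ) ≤ planeEig m ^ p * numIndep m (2 * q + 1) := by
      rw [numIndep_eq_entrySum, numIndep_eq_entrySum, planeEig, planeTransfer_eq]
      exact entrySum_pow_add_le (bondTransfer_isSymm _) (bondTransfer_nonneg _) p q
    have h1 := Real.log_le_log (numIndep_pos m (by omega)) h
    rw [Real.log_mul (pow_pos (planeEig_pos m) p).ne' (numIndep_pos m (by omega)).ne',
      Real.log_pow, numIndep_comm m, numIndep_comm m] at h1
    have h2 := (log_numIndep_bounds (m := p + 2 * q + 1) (by omega) hm).1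
    have h3 := (log_numIndep_bounds (m := 2 * q + 1) (by omega) hm).2
    push_cast at h3
    have h4 : (m - 1) * R - 2 * q * Real.log 3 ≤ p * Real.log (planeEig m) := by
      rw [hR]; linarith
    rw [← mul_div_assoc, le_div_iff₀ hm']
    refine le_trans (le_of_eq ?_) h4
    field_simp
  have hlim : 1 * R - 0 ≤ p * l := by
    refine le_of_tendsto_of_tendsto ((tendsto_one_sub_inv.mul_const R).sub
      (tendsto_const_div_atTop_nhds_zero_nat (2 * q * Real.log 3))) (hl.const_mul (p : ℝ)) ?_
    filter_upwards [eventually_ge_atTop 1] with m hm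
    exact key m hm
  rw [Real.rpow_def_of_pos (div_pos (planeEig_pos _) (planeEig_pos _)),
    Real.log_div (planeEig_pos _).ne' (planeEig_pos _).ne', ← hR, mul_one_div, Real.exp_le_exp,
    div_le_iff₀ hp']
  linarith

theorem limit_le {l : ℝ} (hl : Tendsto (fun m : ℕ => Real.log (planeEig m) / m) atTop (𝓝 l))
    {k : ℕ} (hk : 1 ≤ k) :
    Real.exp l ≤ maxEigenvalue (cylTransfer (2 * k)) ^ ((1 : ℝ) / (2 * (k : ℝ))) := by
  set ξ := maxEigenvalue (cylTransfer (2 * k)) with hξ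
  have hk' : (0 : ℝ) < k := by exact_mod_cast hk
  have h1 : 1 ≤ ξ := by
    rw [hξ, cylTransfer_eq]; exact one_le_maxEigenvalue_bondTransfer _
  have h0 : 0 < ξ := zero_lt_one.trans_le h1
  have key : ∀ m : ℕ, 1 ≤ m → (2 * k) * (Real.log (planeEig m) / m) ≤
      (2 * k * Real.log 3) / m + (1 - 1 / (m : ℝ)) * Real.log ξ := by
    intro m hm
    have hm' : (0 : ℝ) < m := by exact_mod_cast hm
    have h : planeEig m ^ (2 * k) ≤ 3 ^ (2 * k) * ξ ^ (m - 1) := by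
      have ht := trace_planeTransfer_pow hm (c := 2 * k) (by omega)
      have hs := entrySum_bondTransfer_pow_le (ringEnd (2 * k)) (m - 1)
      rw [← cylTransfer_eq] at hs
      refine le_trans ?_ hs
      rw [entrySum, ← ht, planeEig, planeTransfer_eq]
      exact maxEigenvalue_pow_le_trace (bondTransfer_isSymm _) (bondTransfer_nonneg _) k
    have h2 := Real.log_le_log (pow_pos (planeEig_pos m) _) h
    rw [Real.log_mul (by positivity) (by positivity), Real.log_pow, Real.log_pow,
      Real.log_pow] at h2
    push_cast [Nat.cast_sub hm] at h2
    rw [← mul_div_assoc, div_le_iff₀ hm']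
    refine h2.trans (le_of_eq ?_)
    field_simp
  have hlim : (2 * k) * l ≤ 0 + 1 * Real.log ξ := by
    refine le_of_tendsto_of_tendsto (hl.const_mul (2 * k : ℝ))
      ((tendsto_const_div_atTop_nhds_zero_nat (2 * k * Real.log 3)).add
        (tendsto_one_sub_inv.mul_const (Real.log ξ))) ?_
    filter_upwards [eventually_ge_atTop 1] with m hm
    exact key m hm
  rw [Real.rpow_def_of_pos h0, mul_one_div, Real.exp_le_exp, le_div_iff₀ (by positivity)]
  linarith

end Lattice884

namespace Lattice884

/-- The tensor power of a matrix of size two, on 0-1 vectors. -/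
def tensorPow (s : ℕ) (κ : Matrix Bool Bool ℝ) : Matrix (BitVec01 s) (BitVec01 s) ℝ :=
  fun u w => ∏ i, κ (u i) (w i)

theorem tensorPow_mul (s : ℕ) (κ κ' : Matrix Bool Bool ℝ) :
    tensorPow s κ * tensorPow s κ' = tensorPow s (κ * κ') := by
  ext u x
  simp only [Matrix.mul_apply, tensorPow, ← Finset.prod_mul_distrib, Finset.prod_univ_sum,
    Fintype.piFinset_univ]

theorem tensorPow_one (s : ℕ) : tensorPow s 1 = 1 := by
  ext u w
  simp only [tensorPow, Matrix.one_apply, Finset.prod_ite_zero, Finset.mem_univ, true_implies,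
    Finset.prod_const_one, funext_iff]

/-- Orthogonality of single bits. -/
def orthMatrix : Matrix Bool Bool ℝ := fun a b => cond (a && b) 0 1

theorem orthStep_eq (s : ℕ) : orthStep s = tensorPow s orthMatrix := by
  ext u w
  have : ∀ i, orthMatrix (u i) (w i) = if ¬(u i = true ∧ w i = true) then 1 else 0 := by
    intro i; cases u i <;> cases w i <;> simp [orthMatrix]
  simp only [tensorPow, orthStep, this, Finset.prod_ite_zero, Finset.mem_univ, true_implies,
    Finset.prod_const_one]

section Blocked
variable {r s : ℕ} (e : Fin r → Bool → Fin s)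

/-- The cells blocked by a 0-1 vector on the ends of the bonds. -/
def blocked (v : PairVec r) : BitVec01 s :=
  fun i => decide (∃ k b, e k b = i ∧ v.1 (k, b) = true)

theorem forall_blocked (v : PairVec r) (p : Fin s → Prop) :
    (∀ i, blocked e v i = true → p i) ↔ ∀ k b, v.1 (k, b) = true → p (e k b) := by
  simp only [blocked, decide_eq_true_eq]
  exact ⟨fun h k b hv => h _ ⟨k, b, rfl, hv⟩, fun h i ⟨k, b, hi, hv⟩ => hi ▸ h k b hv⟩

theorem bondStep_eq : bondStep e = (orthStep s).submatrix (blocked e) id := by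
  ext v w
  simp only [bondStep, orthStep, Matrix.submatrix_apply, id, not_and,
    forall_blocked e v fun i => ¬w i = true]

/-- The matrix of the bilinear form by which the triple product depends on the blocked cells. -/
def tripleMatrix : Matrix Bool Bool ℝ := fun a b => 3 - a.toNat - b.toNat

theorem bondTransfer_eq :
    bondTransfer e = (tensorPow s tripleMatrix).submatrix (blocked e) (blocked e) := by
  have h : orthMatrix * orthMatrix * orthMatrix = tripleMatrix := by
    ext a b
    cases a <;> cases b <;> simp [Matrix.mul_apply, tripleMatrix, orthMatrix] <;> norm_num
  rw [← h, ← tensorPow_mul, ← tensorPow_mul, ← orthStep_eq, bondTransfer, bondStep_eq]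
  ext v w
  simp only [Matrix.mul_apply, Matrix.submatrix_apply, Matrix.transpose_apply, id]
  refine Finset.sum_congr rfl fun x _ => ?_
  rw [show orthStep s (blocked e w) x = orthStep s x (blocked e w) from
    congrFun (congrFun (orthStep_isSymm s) x) (blocked e w)]

/-- The number of vectors on the ends of the bonds that block a given set of cells. -/
def blockCount (X : BitVec01 s) : ℕ := (Finset.univ.filter fun v => blocked e v = X).card

theorem sum_blocked (g : BitVec01 s → ℝ) :
    ∑ v, g (blocked e v) = ∑ X, blockCount e X * g X := by
  rw [← Finset.sum_fiberwise' Finset.univ (blocked e) g]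
  simp [blockCount]

/-- The matrix of summation over subsets. -/
def subsetMatrix : Matrix Bool Bool ℝ := fun a b => cond (b && !a) 0 1

theorem sum_subset_blockCount (U : BitVec01 s) :
    ∑ X, tensorPow s subsetMatrix U X * blockCount e X =
      ((∏ k, (1 + (U (e k false)).toNat + (U (e k true)).toNat) : ℕ) : ℝ) := by
  have h1 : ∀ v, tensorPow s subsetMatrix U (blocked e v) =
      ((∏ k, if ∀ b, (pairVecEquiv r v k).1 b = true → U (e k b) = true then 1 else 0 : ℕ) : ℝ) := by
    intro v
    have : ∀ i, subsetMatrix (U i) (blocked e v i) =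
        if (blocked e v i = true → U i = true) then (1 : ℝ) else 0 := by
      intro i; cases U i <;> cases blocked e v i <;> simp [subsetMatrix]
    simp only [tensorPow, this, Finset.prod_ite_zero, Finset.mem_univ, true_implies,
      Finset.prod_const_one, forall_blocked e v fun i => U i = true]
    push_cast
    rfl
  have h2 : ∀ a b : Bool, (∑ p : {p : Bool → Bool // ¬(p false = true ∧ p true = true)},
      if ∀ c, p.1 c = true → cond c b a = true then 1 else 0) = 1 + a.toNat + b.toNat := by
    decide
  simp only [mul_comm (tensorPow s subsetMatrix U _)]
  rw [← sum_blocked e, Finset.sum_congr rfl fun v _ => h1 v, ← Nat.cast_sum,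
    (pairVecEquiv r).sum_comp fun w =>
      ∏ k, if ∀ b, (w k).1 b = true → U (e k b) = true then 1 else 0]
  have h3 := Finset.prod_univ_sum (fun _ : Fin r =>
    (Finset.univ : Finset {p : Bool → Bool // ¬(p false = true ∧ p true = true)}))
    fun k p => if ∀ b, p.1 b = true → U (e k b) = true then 1 else 0
  rw [Fintype.piFinset_univ] at h3
  rw [← h3]
  congr 1
  refine Finset.prod_congr rfl fun k _ => ?_
  rw [← h2]
  refine Finset.sum_congr rfl fun p _ => ?_
  congr 1
  refine propext (forall_congr' fun b => ?_)
  cases b <;> rfl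

/-- The matrix of inclusion and exclusion. -/
def moebiusMatrix : Matrix Bool Bool ℝ := fun a b => cond a (cond b 1 (-1)) (cond b 0 1)

theorem eq_of_sum_subset_eq {c c' : BitVec01 s → ℝ}
    (h : ∀ U, ∑ X, tensorPow s subsetMatrix U X * c X = ∑ X, tensorPow s subsetMatrix U X * c' X) :
    c = c' := by
  have h1 : moebiusMatrix * subsetMatrix = 1 := by
    ext a b
    cases a <;> cases b <;> simp [Matrix.mul_apply, subsetMatrix, moebiusMatrix]
  have h2 : (tensorPow s subsetMatrix).mulVec c = (tensorPow s subsetMatrix).mulVec c' := funext h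
  have h3 := congrArg (tensorPow s moebiusMatrix).mulVec h2
  rwa [Matrix.mulVec_mulVec, Matrix.mulVec_mulVec, tensorPow_mul, h1, tensorPow_one,
    Matrix.one_mulVec, Matrix.one_mulVec] at h3

theorem maxEigenvalue_bondTransfer_le {y : BitVec01 s → ℝ} (hy : ∀ X, 0 < y X) {μ : ℝ}
    (h : ∀ U, ∑ X, tensorPow s tripleMatrix U X * (blockCount e X * y X) ≤ μ * y U) :
    maxEigenvalue (bondTransfer e) ≤ μ := by
  refine maxEigenvalue_le_of_supersolution (bondTransfer_isSymm e) (bondTransfer_nonneg e)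
    (y := fun v => y (blocked e v)) (fun v => hy _) fun v => ?_
  refine le_trans (le_of_eq ?_) (h (blocked e v))
  rw [bondTransfer_eq]
  simp only [Matrix.submatrix_apply]
  rw [sum_blocked e fun X => tensorPow s tripleMatrix (blocked e v) X * y X]
  exact Finset.sum_congr rfl fun X _ => by ring

end Blocked

end Lattice884

namespace Lattice884

/-- Families of natural numbers indexed by the 0-1 vectors of length `n`, as binary trees. -/
@[reducible] def Cube : ℕ → Type := Nat.rec ℕ fun _ T => T × T

noncomputable section

namespace Cube

/-- The entry at a 0-1 vector. -/
def eval : ∀ n, Cube n → (Fin n → Bool) → ℕ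
  | 0, a, _ => a
  | n + 1, s, u => cond (u 0) (eval n s.2 (Fin.tail u)) (eval n s.1 (Fin.tail u))

/-- Entrywise application of a binary operation. -/
def zip (f : ℕ → ℕ → ℕ) (n : ℕ) : Cube n → Cube n → Cube n :=
  Nat.rec f (fun _ ih s t => (ih s.1 t.1, ih s.2 t.2)) n

/-- Replacement, in all directions of the cube, of the two values by two functions of them. -/
def lin (f g : ℕ → ℕ → ℕ) (n : ℕ) : Cube n → Cube n :=
  Nat.rec (fun a => a)
    (fun n ih s => (fun l r => (zip f n l r, zip g n l r)) (ih s.1) (ih s.2)) n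

/-- The test whether a relation holds between all corresponding entries. -/
def all (p : ℕ → ℕ → Bool) (n : ℕ) : Cube n → Cube n → Bool :=
  Nat.rec p (fun _ ih s t => Bool.rec false (ih s.2 t.2) (ih s.1 t.1)) n

/-- The family `p * d ^ (number of zeros) * a ^ (number of ones)`. -/
def weight (a d : ℕ) : ∀ n : ℕ, ℕ → Cube n
  | 0, p => p
  | n + 1, p => (weight a d n (Nat.mul d p), weight a d n (Nat.mul a p))

/-- Product of `1 + x + y` over the pairs of consecutive entries `x, y` of a vector that is
preceded by `prev` and followed by `last`. -/
def chain (last : ℕ) : ∀ n : ℕ, ℕ → ℕ → Cube n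
  | 0, prev, acc => Nat.mul acc (Nat.add (Nat.succ last) prev)
  | n + 1, prev, acc => (chain last n 0 (Nat.mul acc (Nat.succ prev)),
      chain last n 1 (Nat.mul acc (Nat.add prev 2)))

/-- Product of `1 + x + y` over the pairs of cyclically consecutive entries `x, y`. -/
def ring (n : ℕ) : Cube (n + 1) := (chain 0 n 0 1, chain 1 n 1 1)

/-- Summation over subsets. -/
def zeta (n : ℕ) : Cube n → Cube n := lin (fun a _ => a) (fun a b => Nat.add a b) n

/-- Inclusion and exclusion. -/
def moebius (n : ℕ) : Cube n → Cube n := lin (fun a _ => a) (fun a b => Nat.sub b a) n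

/-- Multiplication by the tensor power of `tripleMatrix`. -/
def triple (n : ℕ) : Cube n → Cube n :=
  lin (fun a b => Nat.add (Nat.mul a 3) (Nat.mul b 2)) (fun a b => Nat.add (Nat.mul a 2) b) n

/-- Power iteration with the shift `σ`. -/
def iter {n : ℕ} (σ : ℕ) (c : Cube n) : ℕ → Cube n → Cube n
  | 0, t => t
  | k + 1, t => iter σ c k
      (zip (fun a b => Nat.add a (Nat.mul σ b)) n (triple n (zip Nat.mul n c t)) t)

theorem eval_zip (f : ℕ → ℕ → ℕ) : ∀ (n : ℕ) (s t : Cube n) (u : Fin n → Bool),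
    eval n (zip f n s t) u = f (eval n s u) (eval n t u)
  | 0, _, _, _ => rfl
  | n + 1, s, t, u => by
    change cond (u 0) (eval n (zip f n s.2 t.2) _) (eval n (zip f n s.1 t.1) _) =
      f (cond (u 0) (eval n s.2 _) (eval n s.1 _)) (cond (u 0) (eval n t.2 _) (eval n t.1 _))
    cases u 0 <;> exact eval_zip f n _ _ _

theorem eval_lin {f g : ℕ → ℕ → ℕ} {κ : Matrix Bool Bool ℝ}
    (hf : ∀ a b : ℕ, (f a b : ℝ) = κ false false * a + κ false true * b)
    (hg : ∀ a b : ℕ, (g a b : ℝ) = κ true false * a + κ true true * b) :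
    ∀ (n : ℕ) (s : Cube n) (u : Fin n → Bool),
      (eval n (lin f g n s) u : ℝ) = ∑ w, tensorPow n κ u w * eval n s w
  | 0, s, u => by
    rw [Fintype.sum_unique, tensorPow, Finset.univ_eq_empty, Finset.prod_empty, one_mul]
    rfl
  | n + 1, s, u => by
    have h : ∀ b : Bool, ∑ w : Fin n → Bool, tensorPow (n + 1) κ u (Fin.cons b w) *
        (eval (n + 1) s (Fin.cons b w) : ℝ) =
        κ (u 0) b * eval n (lin f g n (cond b s.2 s.1)) (Fin.tail u) := by
      intro b
      rw [eval_lin hf hg n, Finset.mul_sum]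
      refine Finset.sum_congr rfl fun w _ => ?_
      rw [tensorPow, Fin.prod_univ_succ, mul_assoc]
      cases b <;> rfl
    rw [sum_fin_succ_pi, Fintype.sum_bool, h, h]
    change ((cond (u 0) (eval n (zip g n (lin f g n s.1) (lin f g n s.2)) (Fin.tail u))
      (eval n (zip f n (lin f g n s.1) (lin f g n s.2)) (Fin.tail u)) : ℕ) : ℝ) = _
    rw [eval_zip, eval_zip]
    cases u 0
    · rw [cond_false, hf]; exact add_comm _ _
    · rw [cond_true, hg]; exact add_comm _ _

theorem forall_of_all {p : ℕ → ℕ → Bool} : ∀ (n : ℕ) (s t : Cube n), all p n s t = true →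
    ∀ u, p (eval n s u) (eval n t u) = true
  | 0, _, _, h, _ => h
  | n + 1, s, t, h, u => by
    have h' : Bool.rec (motive := fun _ => Bool) false (all p n s.2 t.2) (all p n s.1 t.1) =
      true := h
    cases h1 : all p n s.1 t.1
    · rw [h1] at h'; exact absurd h' (by simp)
    · rw [h1] at h'
      change p (cond (u 0) (eval n s.2 _) (eval n s.1 _))
        (cond (u 0) (eval n t.2 _) (eval n t.1 _)) = true
      cases u 0
      · exact forall_of_all n _ _ h1 _
      · exact forall_of_all n _ _ h' _

theorem eval_weight_pos {a d : ℕ} (ha : 0 < a) (hd : 0 < d) : ∀ (n p : ℕ) (u : Fin n → Bool),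
    0 < p → 0 < eval n (weight a d n p) u
  | 0, _, _, hp => hp
  | n + 1, p, u, hp => by
    change 0 < cond (u 0) (eval n (weight a d n (a * p)) _) (eval n (weight a d n (d * p)) _)
    cases u 0
    · exact eval_weight_pos ha hd n _ _ (Nat.mul_pos hd hp)
    · exact eval_weight_pos ha hd n _ _ (Nat.mul_pos ha hp)

theorem eval_iter_pos {n σ : ℕ} (hσ : 0 < σ) (c : Cube n) : ∀ (k : ℕ) (t : Cube n),
    (∀ u, 0 < eval n t u) → ∀ u, 0 < eval n (iter σ c k t) u
  | 0, _, h, u => h u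
  | k + 1, t, h, u => by
    refine eval_iter_pos hσ c k _ (fun w => ?_) u
    rw [eval_zip]
    exact Nat.add_pos_right _ (Nat.mul_pos hσ (h w))

theorem eval_chain (last : ℕ) : ∀ (n : ℕ) (prev : Bool) (acc : ℕ) (u : Fin n → Bool),
    eval n (chain last n prev.toNat acc) u =
      acc * ((∏ i : Fin n, (1 + ((Fin.cons prev u : Fin (n + 1) → Bool) i.castSucc).toNat +
        (u i).toNat)) *
        (1 + ((Fin.cons prev u : Fin (n + 1) → Bool) (Fin.last n)).toNat + last))
  | 0, prev, acc, u => by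
    change acc * (last + 1 + prev.toNat) = acc * (1 * (1 + prev.toNat + last))
    rw [one_mul]
    congr 1
    omega
  | n + 1, prev, acc, u => by
    rw [Fin.prod_univ_succ]
    have h : eval (n + 1) (chain last (n + 1) prev.toNat acc) u =
        eval n (chain last n (u 0).toNat (acc * (1 + prev.toNat + (u 0).toNat))) (Fin.tail u) := by
      change cond (u 0) (eval n (chain last n 1 (acc * (prev.toNat + 2))) _)
        (eval n (chain last n 0 (acc * (prev.toNat + 1))) _) = _
      cases u 0
      · rw [Nat.add_comm prev.toNat 1]; rfl
      · rw [show prev.toNat + 2 = 1 + prev.toNat + 1 by omega]; rfl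
    rw [h, eval_chain last n, mul_assoc, mul_assoc]
    have hu : (Fin.cons (u 0) (Fin.tail u) : Fin (n + 1) → Bool) = u := Fin.cons_self_tail u
    rw [hu]
    rfl

theorem eval_ring (n : ℕ) (u : Fin (n + 1) → Bool) :
    eval (n + 1) (ring n) u =
      ∏ k, (1 + (u (ringEnd (n + 1) k false)).toNat + (u (ringEnd (n + 1) k true)).toNat) := by
  have h : eval (n + 1) (ring n) u =
      eval n (chain (u 0).toNat n (u 0).toNat 1) (Fin.tail u) := by
    change cond (u 0) (eval n (chain 1 n 1 1) _) (eval n (chain 0 n 0 1) _) = _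
    cases u 0 <;> rfl
  have h0 : ∀ k, ringEnd (n + 1) k false = k := fun k => Fin.ext (Nat.mod_eq_of_lt k.isLt)
  have h1 : ∀ k : Fin n, ringEnd (n + 1) k.castSucc true = k.succ := fun k =>
    Fin.ext (Nat.mod_eq_of_lt k.succ.isLt)
  have h2 : ringEnd (n + 1) (Fin.last n) true = 0 := Fin.ext (Nat.mod_self (n + 1))
  have hu : (Fin.cons (u 0) (Fin.tail u) : Fin (n + 1) → Bool) = u := Fin.cons_self_tail u
  rw [h, eval_chain, one_mul, hu, Fin.prod_univ_castSucc]
  simp only [h0, h1, h2]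
  rfl

end Cube

/-- The numbers of the vectors on a ring of ten bonds that block given sets of cells. -/
def ringCount : Cube 10 := Cube.moebius 10 (Cube.ring 9)

/-- An approximate Perron vector of the ring of ten bonds. -/
def ringVector : Cube 10 := Cube.iter 811000 ringCount 5 (Cube.weight 598 1000 10 1)

theorem zeta_ringCount :
    Cube.all Nat.beq 10 (Cube.zeta 10 ringCount) (Cube.ring 9) = true := by
  decide +kernel

theorem triple_ringVector :
    Cube.all (fun a b => Nat.ble (Nat.mul (10 ^ 100) a) (Nat.mul (57654565289 ^ 10) b)) 10
      (Cube.triple 10 (Cube.zip Nat.mul 10 ringCount ringVector)) ringVector = true := by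
  decide +kernel

theorem eval_ringCount :
    (fun X => (Cube.eval 10 ringCount X : ℝ)) = fun X => (blockCount (ringEnd 10) X : ℝ) := by
  refine eq_of_sum_subset_eq fun U => ?_
  rw [sum_subset_blockCount, ← Cube.eval_ring,
    ← Nat.eq_of_beq_eq_true (Cube.forall_of_all _ _ _ zeta_ringCount U), Cube.zeta,
    Cube.eval_lin (κ := subsetMatrix)] <;> intro a b <;> simp [subsetMatrix]

theorem maxEigenvalue_cylTransfer_ten_le :
    maxEigenvalue (cylTransfer 10) ≤ (5.7654565289 : ℝ) ^ 10 := by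
  rw [cylTransfer_eq]
  refine maxEigenvalue_bondTransfer_le (ringEnd 10)
    (y := fun X => (Cube.eval 10 ringVector X : ℝ)) (fun X => ?_) fun U => ?_
  · exact Nat.cast_pos.2 (Cube.eval_iter_pos (by norm_num) _ _ _
      (fun u => Cube.eval_weight_pos (by norm_num) (by norm_num) _ _ _ one_pos) X)
  · have h := Nat.le_of_ble_eq_true (Cube.forall_of_all _ _ _ triple_ringVector U)
    have h' : ((10 ^ 100 * Cube.eval 10
        (Cube.triple 10 (Cube.zip Nat.mul 10 ringCount ringVector)) U : ℕ) : ℝ) ≤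
        ((57654565289 ^ 10 * Cube.eval 10 ringVector U : ℕ) : ℝ) := Nat.cast_le.2 h
    have hl : (Cube.eval 10 (Cube.triple 10 (Cube.zip Nat.mul 10 ringCount ringVector)) U : ℝ) =
        ∑ X, tensorPow 10 tripleMatrix U X *
          (blockCount (ringEnd 10) X * Cube.eval 10 ringVector X) := by
      rw [Cube.triple, Cube.eval_lin (κ := tripleMatrix)]
      · refine Finset.sum_congr rfl fun X _ => ?_
        rw [Cube.eval_zip, ← congrFun eval_ringCount X]
        exact congrArg _ (Nat.cast_mul _ _)
      · intro a b
        simp [tripleMatrix]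
        ring
      · intro a b
        simp [tripleMatrix]
        ring
    rw [Nat.cast_mul, Nat.cast_mul, Nat.cast_pow, Nat.cast_pow, hl] at h'
    rw [show (5.7654565289 : ℝ) = 57654565289 / 10 ^ 10 by norm_num, div_pow, ← pow_mul,
      div_mul_eq_mul_div, le_div_iff₀ (by positivity), mul_comm]
    exact_mod_cast h'

end

end Lattice884

namespace Lattice884

theorem planeEig_one_le : planeEig 1 ≤ 3 := by
  rw [planeEig, planeTransfer_eq]
  refine maxEigenvalue_le_of_supersolution (bondTransfer_isSymm _) (bondTransfer_nonneg _)
    (y := fun _ => 1) (fun _ => one_pos) fun u => ?_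
  refine (Finset.sum_le_card_nsmul _ _ 3 fun v _ => ?_).trans_eq ?_
  · rw [mul_one]
    exact (bondTransfer_le (pathEnd 1) u v).trans_eq (pow_one 3)
  · rw [Finset.card_univ, card_pairVec]; simp

theorem numIndep_two_two : numIndep 2 2 = 47 := by
  rw [numIndep_eq]
  decide +kernel

theorem le_planeEig_two : 47 / 3 ≤ planeEig 2 := by
  have h := numIndep_le 2 1
  rw [numIndep_two_two] at h
  norm_num at h
  linarith

end Lattice884

theorem mainTheorem5 :
    (∀ m n : ℕ, 1 ≤ m → 1 ≤ n →
      (Lattice884.planeTransfer m).IsSymm ∧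
      (Lattice884.numIndep m n : ℝ) =
        ∑ u, ∑ v, (Lattice884.planeTransfer m ^ (n - 1)) u v ∧
      (Fintype.card (Lattice884.Vert m n) : ℤ) = 4 * m * n - 2 * m - 2 * n) ∧
    ∃ L η : ℝ,
      Tendsto (fun p : ℕ × ℕ =>
        (Lattice884.numIndep p.1 p.2 : ℝ) ^ ((1 : ℝ) / ((p.1 : ℝ) * (p.2 : ℝ))))
        (atTop ×ˢ atTop) (𝓝 L) ∧
      (∀ p q : ℕ, 1 ≤ p →
        (Lattice884.maxEigenvalue (Lattice884.planeTransfer (p + 2 * q + 1)) /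
          Lattice884.maxEigenvalue (Lattice884.planeTransfer (2 * q + 1))) ^ ((1 : ℝ) / (p : ℝ))
          ≤ L) ∧
      (∀ k : ℕ, 1 ≤ k →
        L ≤ Lattice884.maxEigenvalue (Lattice884.cylTransfer (2 * k)) ^
          ((1 : ℝ) / (2 * (k : ℝ)))) ∧
      (4.631583396 : ℝ) ≤ L ∧ L < (5.765456529 : ℝ) ∧
      Tendsto (fun p : ℕ × ℕ =>
        (Lattice884.numIndep p.1 p.2 : ℝ) ^
          ((1 : ℝ) / (Fintype.card (Lattice884.Vert p.1 p.2) : ℝ)))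
        (atTop ×ˢ atTop) (𝓝 η) ∧
      η = L ^ ((1 : ℝ) / 4) ∧
      (1.467007629 : ℝ) ≤ η ∧ η < (1.549560102 : ℝ) := by
  refine ⟨fun m n hm hn => ⟨?_, Lattice884.numIndep_eq_sum m hn, Lattice884.card_vert hm hn⟩, ?_⟩
  · rw [Lattice884.planeTransfer_eq]; exact Lattice884.bondTransfer_isSymm _
  obtain ⟨l, hl⟩ := Lattice884.exists_tendsto_log_planeEig
  have hη : Real.exp (l / 4) = Real.exp l ^ ((1 : ℝ) / 4) := by
    rw [← Real.exp_mul, mul_one_div]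
  have hη4 : Real.exp (l / 4) ^ 4 = Real.exp l := by
    rw [← Real.exp_nat_mul]; congr 1; push_cast; ring
  have hlow : (5 : ℝ) ≤ Real.exp l := by
    have h := Lattice884.le_limit hl (p := 1) 0 le_rfl
    norm_num at h
    refine le_trans ?_ h
    rw [le_div_iff₀ (Lattice884.planeEig_pos 1)]
    linarith [Lattice884.planeEig_one_le, Lattice884.le_planeEig_two]
  have hupp : Real.exp l ≤ 5.7654565289 := by
    refine (Lattice884.limit_le hl (k := 5) (by norm_num)).trans ?_
    have h0 : (0 : ℝ) ≤ Lattice884.maxEigenvalue (Lattice884.cylTransfer (2 * 5)) := by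
      rw [Lattice884.cylTransfer_eq]
      exact zero_le_one.trans (Lattice884.one_le_maxEigenvalue_bondTransfer _)
    refine (Real.rpow_le_rpow h0 Lattice884.maxEigenvalue_cylTransfer_ten_le
      (by positivity)).trans_eq ?_
    rw [← Real.rpow_natCast, ← Real.rpow_mul (by norm_num)]
    norm_num
  refine ⟨Real.exp l, Real.exp (l / 4), Lattice884.tendsto_numIndep_rpow hl,
    fun p q hp => Lattice884.le_limit hl q hp, fun k hk => Lattice884.limit_le hl hk,
    le_trans (by norm_num) hlow, lt_of_le_of_lt hupp (by norm_num),
    Lattice884.tendsto_numIndep_rpow_card hl, hη, ?_, ?_⟩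
  · refine le_of_pow_le_pow_left₀ (n := 4) (by norm_num) (Real.exp_pos _).le ?_
    rw [hη4]
    exact le_trans (by norm_num) hlow
  · refine lt_of_pow_lt_pow_left₀ 4 (by norm_num) ?_
    rw [hη4]
    exact lt_of_le_of_lt hupp (by norm_num)
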